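/- Let $(A,\mathfrak m)$ and $(R,\mathfrak n)$ be Noetherian local rings, and let $A\to R$ be a flat local homomorphism. Put $k=A/\mathfrak m$ and $K=R/\mathfrak n$, and suppose that the (not necessarily algebraic) field extension $K/k$ is separable, that is, $L\otimes_k K$ is reduced for every field extension $L/k$. Suppose that $R\otimes_A k$ is a regular ring. Let $I\subset R$ be a proper ideal such that: (a) for every prime ideal $\mathfrak q$ of $R$ containing $I$, the preimage of $\mathfrak q$ in $A$ is not contained in any associated prime ideal of $A$; (b) $I\not\subset\mathfrak mR$. Then $\operatorname{depth}(I,R)\ge 2$, where $\operatorname{depth}(I,R)$ denotes the maximal length of an $R$-regular sequence of elements of $I$. -/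

import Mathlib

open scoped TensorProduct

universe u v

/-- A field extension `K / k` (not necessarily algebraic) is separable if `L ⊗[k] K` is reduced for
every field extension `L` of `k`. Letting `L` range over the universe of `k` is no loss: this
universe contains an algebraic closure of `k`, which already detects separability. -/
def IsSeparableFieldExtension (k : Type u) (K : Type v) [Field k] [Field K] [Algebra k K] : Prop :=
  ∀ (L : Type u) [Field L] [Algebra k L], IsReduced (L ⊗[k] K)

/-- `depth(I, R)`, the maximal length of an `R`-regular sequence of elements of `I`, as an element
of `ℕ∞` (used for proper ideals `I` of Noetherian rings, where all the maximal regular sequences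
in `I` have the same finite length). -/
noncomputable def idealDepth {R : Type v} [CommRing R] (I : Ideal R) : ℕ∞ :=
  ⨆ (rs : List R) (_ : RingTheory.Sequence.IsRegular R rs) (_ : ∀ r ∈ rs, r ∈ I),
    (rs.length : ℕ∞)

open IsLocalRing

/-! The closed fibre `R ⧸ m`, with `m` the extension of the maximal ideal of `A`, is regular local,
hence a domain, so `m` is prime. Condition (a) and prime avoidance give a nonzerodivisor `a` of `A`
whose image lies in `I`; by flatness it stays regular on `R`. Condition (b) gives `x ∈ I` outside
the prime `m`, so `x` is regular on the closed fibre. Flatness spreads this from `R ⧸ m` to `R ⧸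
aR`, by dévissage for ideals containing a power of `maximalIdeal A` and then Krull's intersection
theorem. Thus `a, x` is a regular sequence in `I`. -/

/-- An element of the maximal ideal outside its square belongs to a minimal system of generators,
so that dividing by it lowers the embedding dimension. -/
theorem IsLocalRing.spanFinrank_maximalIdeal_quotient_span_singleton_add_one_le
    {R : Type*} [CommRing R] [IsLocalRing R] [IsNoetherianRing R] {x : R}
    [IsLocalRing (R ⧸ Ideal.span {x})] (hx : x ∈ maximalIdeal R) (hx2 : x ∉ maximalIdeal R ^ 2) :
    (maximalIdeal (R ⧸ Ideal.span {x})).spanFinrank + 1 ≤ (maximalIdeal R).spanFinrank := by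
  let y : maximalIdeal R := ⟨x, hx⟩
  let e : CotangentSpace R := (maximalIdeal R).toCotangent y
  have he : e ≠ 0 := fun h ↦ hx2 (((maximalIdeal R).toCotangent_eq_zero y).1 h)
  let W : Submodule (ResidueField R) (CotangentSpace R) := Submodule.span _ {e}
  -- Lifts of a basis of the cotangent space modulo the class of `x` generate the maximal ideal
  -- together with `x`, by Nakayama.
  let b := Module.finBasis (ResidueField R) (CotangentSpace R ⧸ W)
  have hlift : ∀ i, ∃ t : maximalIdeal R,
      W.mkQ (show CotangentSpace R from (maximalIdeal R).toCotangent t) = b i := by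
    intro i
    obtain ⟨c, hc⟩ := W.mkQ_surjective (b i)
    obtain ⟨t, ht⟩ := (maximalIdeal R).toCotangent_surjective c
    exact ⟨t, by rw [← hc, ← ht]⟩
  choose t ht using hlift
  have hgen : Submodule.span (ResidueField R)
      ((maximalIdeal R).toCotangent '' (insert y (Set.range t)) : Set (CotangentSpace R)) = ⊤ := by
    set U := Submodule.span (ResidueField R)
      ((maximalIdeal R).toCotangent '' (insert y (Set.range t)) : Set (CotangentSpace R)) with hU
    have hW : W ≤ U := by
      rw [Submodule.span_singleton_le_iff_mem]
      exact Submodule.subset_span ⟨y, Set.mem_insert _ _, rfl⟩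
    have hmap : U.map W.mkQ = ⊤ := by
      rw [eq_top_iff, ← b.span_eq, Submodule.span_le]
      rintro _ ⟨i, rfl⟩
      exact ⟨_, Submodule.subset_span ⟨t i, Set.mem_insert_of_mem _ ⟨i, rfl⟩, rfl⟩, ht i⟩
    have := congrArg (Submodule.comap W.mkQ) hmap
    rwa [Submodule.comap_map_mkQ, Submodule.comap_top, sup_eq_right.2 hW] at this
  have hspan := CotangentSpace.span_image_eq_top_iff.1 hgen
  have hm : maximalIdeal R = Ideal.span (insert x (Set.range fun i ↦ (t i : R))) := by
    have := congrArg (Submodule.map (maximalIdeal R).subtype) hspan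
    rw [Submodule.map_span, Submodule.map_top, Submodule.range_subtype, Set.image_insert_eq,
      ← Set.range_comp] at this
    exact this.symm
  have hquot : maximalIdeal (R ⧸ Ideal.span {x}) =
      Ideal.span (Set.range fun i ↦ Ideal.Quotient.mk (Ideal.span {x}) (t i : R)) := by
    rw [← IsLocalRing.map_maximalIdeal_of_surjective _
      (Ideal.Quotient.mk_surjective (I := Ideal.span {x}))]
    refine (congrArg _ hm).trans ?_
    rw [Ideal.map_span, Set.image_insert_eq, ← Set.range_comp,
      Ideal.Quotient.eq_zero_iff_mem.2 (Ideal.mem_span_singleton_self x), Ideal.span_insert_zero]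
    rfl
  have h1 : (maximalIdeal (R ⧸ Ideal.span {x})).spanFinrank ≤
      Module.finrank (ResidueField R) (CotangentSpace R ⧸ W) := by
    rw [hquot]
    refine (Submodule.spanFinrank_span_le_ncard_of_finite (Set.finite_range _)).trans ?_
    rw [← Set.image_univ]
    refine (Set.ncard_image_le Set.finite_univ).trans ?_
    rw [Set.ncard_univ, Nat.card_eq_fintype_card, Fintype.card_fin]
  rw [spanFinrank_maximalIdeal_eq_finrank_cotangentSpace (R := R), ← W.finrank_quotient_add_finrank,
    finrank_span_singleton he]
  exact Nat.add_le_add_right h1 1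

/-- A regular local ring is a domain. -/
theorem IsRegularLocalRing.isDomain {R : Type*} [CommRing R] [IsRegularLocalRing R] :
    IsDomain R := by
  obtain ⟨n, hn⟩ : ∃ n, (maximalIdeal R).spanFinrank = n := ⟨_, rfl⟩
  induction n generalizing R with
  | zero =>
    rw [Submodule.spanFinrank_eq_zero_iff_eq_bot (maximalIdeal R).fg_of_isNoetherianRing] at hn
    exact (isField_iff_maximalIdeal_eq.2 hn).isDomain
  | succ n ih =>
    have hdim : (maximalIdeal R).spanFinrank = ringKrullDim R :=
      IsRegularLocalRing.spanFinrank_maximalIdeal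
    -- Prime avoidance tolerates the non-prime ideal `maximalIdeal R ^ 2`. Failure would make the
    -- maximal ideal idempotent, hence zero, or a minimal prime, against dimension `n + 1`.
    obtain ⟨x, hxm, hx⟩ : ∃ x ∈ maximalIdeal R,
        x ∉ ⋃ I ∈ insert (maximalIdeal R ^ 2) (minimalPrimes R), (I : Set R) := by
      by_contra! h
      obtain ⟨I, hI, hle⟩ := (Ideal.subset_union_prime_finite
        ((minimalPrimes.finite_of_isNoetherianRing R).insert (maximalIdeal R ^ 2)) (f := id)
        (maximalIdeal R ^ 2) (maximalIdeal R ^ 2)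
        (fun I hI h _ ↦ (hI.resolve_left h).1.1)).1 h
      rcases hI with rfl | hI
      · have hidem : IsIdempotentElem (maximalIdeal R) :=
          le_antisymm Ideal.mul_le_left (by simpa [pow_two] using hle)
        rcases (Ideal.isIdempotentElem_iff_eq_bot_or_top_of_isLocalRing _).1 hidem with h | h
        · rw [h, Submodule.spanFinrank_bot] at hn
          omega
        · exact (maximalIdeal.isMaximal R).ne_top h
      · have hh : (maximalIdeal R).height = 0 := by
          have : maximalIdeal R = I := le_antisymm hle (le_maximalIdeal hI.1.1.ne_top)
          have : I.IsPrime := hI.1.1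
          rw [‹maximalIdeal R = I›]
          exact Ideal.height_eq_zero_iff.2 hI
        rw [← maximalIdeal_height_eq_ringKrullDim, hh, hn] at hdim
        norm_cast at hdim
    simp only [Set.mem_iUnion, not_exists] at hx
    have hx2 : x ∉ maximalIdeal R ^ 2 := hx _ (Set.mem_insert _ _)
    have : Nontrivial (R ⧸ Ideal.span {x}) := Ideal.Quotient.nontrivial_iff.2 fun h ↦
      (maximalIdeal.isMaximal R).ne_top
        (top_le_iff.1 (h ▸ (Ideal.span_singleton_le_iff_mem _).2 hxm))
    have : IsLocalRing (R ⧸ Ideal.span {x}) :=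
      .of_surjective' _ Ideal.Quotient.mk_surjective
    have hgen := spanFinrank_maximalIdeal_quotient_span_singleton_add_one_le hxm hx2
    have hdimq : ringKrullDim R ≤ ringKrullDim (R ⧸ Ideal.span {x}) + 1 := by
      rw [← maximalIdeal_height_eq_ringKrullDim]
      exact Ideal.height_le_ringKrullDim_quotient_add_one hxm
    have hle := ringKrullDim_le_spanFinrank_maximalIdeal (R ⧸ Ideal.span {x})
    -- Dividing by `x` lowers the dimension by at most one and the embedding dimension by at least
    -- one, so both become `n`.
    have hn' : (maximalIdeal (R ⧸ Ideal.span {x})).spanFinrank = n := by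
      have h2 : ((maximalIdeal R).spanFinrank : WithBot ℕ∞) ≤
          ((maximalIdeal (R ⧸ Ideal.span {x})).spanFinrank : WithBot ℕ∞) + 1 :=
        hdim.le.trans (hdimq.trans (add_le_add_left hle 1))
      norm_cast at h2
      omega
    have : IsRegularLocalRing (R ⧸ Ideal.span {x}) := by
      refine .of_spanFinrank_maximalIdeal_le _ ?_
      rw [hn']
      rw [← hdim, hn] at hdimq
      push_cast at hdimq
      exact (ENat.WithBot.add_le_add_one_right_iff).1 hdimq
    have := ih hn'
    have hprime : (Ideal.span {x}).IsPrime := (Ideal.Quotient.isDomain_iff_prime _).1 this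
    obtain ⟨q, hq, hqx⟩ := Ideal.exists_minimalPrimes_le (bot_le : ⊥ ≤ Ideal.span {x})
    have hxq : x ∉ q := hx q (Set.mem_insert_of_mem _ hq)
    have : q.IsPrime := hq.1.1
    -- As `x ∉ q`, any `x * z ∈ q` has `z ∈ q`; hence `q` lies in `maximalIdeal R • q`, and Nakayama
    -- applies.
    have hqbot : q = ⊥ := by
      refine Submodule.eq_bot_of_le_smul_of_le_jacobson_bot (maximalIdeal R) q
        q.fg_of_isNoetherianRing (fun y hy ↦ ?_) (maximalIdeal_le_jacobson _)
      obtain ⟨z, rfl⟩ := Ideal.mem_span_singleton.1 (hqx hy)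
      exact Submodule.smul_mem_smul hxm ((Ideal.IsPrime.mem_or_mem ‹_› hy).resolve_left hxq)
    rw [hqbot] at this
    exact IsDomain.of_bot_isPrime R

/-- Flat extensions commute with colon ideals: if `s • t ∈ J S` then `t ∈ (J : s) S`. -/
theorem Module.Flat.mem_map_colon_of_algebraMap_mul_mem {A S : Type*} [CommRing A] [CommRing S]
    [Algebra A S] [Module.Flat A S] {J L : Ideal A} {s : A} (hL : ∀ a, a * s ∈ J → a ∈ L)
    {t : S} (h : algebraMap A S s * t ∈ J.map (algebraMap A S)) :
    t ∈ L.map (algebraMap A S) := by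
  -- `L'` is the exact colon ideal, so multiplication by `s` embeds `A ⧸ L'` in `A ⧸ J`, and
  -- flatness preserves this injection.
  let L' : Ideal A := Submodule.comap (LinearMap.mulRight A s) J
  suffices ht : t ∈ L'.map (algebraMap A S) from Ideal.map_mono (show L' ≤ L from hL) ht
  let f : (A ⧸ L') →ₗ[A] (A ⧸ J) := Submodule.mapQ L' J (LinearMap.mulRight A s) le_rfl
  have hf : Function.Injective f := by
    rw [← LinearMap.ker_eq_bot, Submodule.ker_mapQ]
    exact Submodule.mkQ_map_self L'
  have hinj := Module.Flat.lTensor_preserves_injective_linearMap (M := S) f hf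
  have h0 : (t ⊗ₜ[A] (1 : A ⧸ L')) = 0 := by
    apply hinj
    rw [map_zero, LinearMap.lTensor_tmul]
    have : f 1 = s • (1 : A ⧸ J) :=
      congrArg (Submodule.Quotient.mk (p := J)) (mul_comm (1 : A) s)
    rw [this, TensorProduct.tmul_smul, TensorProduct.smul_tmul',
      ← Algebra.TensorProduct.quotIdealMapEquivTensorQuot_mk, Algebra.smul_def,
      Ideal.Quotient.eq_zero_iff_mem.2 h, map_zero]
  rw [← Algebra.TensorProduct.quotIdealMapEquivTensorQuot_mk, map_eq_zero_iff _
    (AlgEquiv.injective _)] at h0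
  exact Ideal.Quotient.eq_zero_iff_mem.1 h0

/-- Let `A → S` be a flat local homomorphism of Noetherian local rings. An element of `S` which is
regular on the closed fibre is regular on `S / J S` for every ideal `J` of `A`. -/
theorem Module.Flat.mem_map_of_mul_mem_map {A S : Type*} [CommRing A] [CommRing S]
    [IsLocalRing A] [IsLocalRing S] [IsNoetherianRing A] [IsNoetherianRing S] [Algebra A S]
    [IsLocalHom (algebraMap A S)] [Module.Flat A S] {x : S}
    (hx : ∀ r, x * r ∈ (maximalIdeal A).map (algebraMap A S) →
      r ∈ (maximalIdeal A).map (algebraMap A S))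
    (J : Ideal A) {r : S} (hr : x * r ∈ J.map (algebraMap A S)) : r ∈ J.map (algebraMap A S) := by
  have key : ∀ (n : ℕ) (J : Ideal A), maximalIdeal A ^ n ≤ J → ∀ r : S,
      x * r ∈ J.map (algebraMap A S) → r ∈ J.map (algebraMap A S) := by
    intro n J
    induction J using WellFoundedGT.induction with
    | ind J ih =>
    intro hn r hr
    by_cases htop : J = ⊤
    · rw [htop, Ideal.map_top]; trivial
    have hex : ∃ k, maximalIdeal A ^ k ≤ J := ⟨n, hn⟩
    classical
    have hk0 : Nat.find hex ≠ 0 := fun h ↦ htop (by simpa [h] using Nat.find_spec hex)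
    obtain ⟨k, hk⟩ := Nat.exists_eq_succ_of_ne_zero hk0
    have hkJ : maximalIdeal A ^ (k + 1) ≤ J := by have := Nat.find_spec hex; rwa [hk] at this
    -- Since `k + 1` is the least exponent with the power inside `J`, this `s` is a socle element
    -- modulo `J`: its colon ideal is `maximalIdeal A`.
    obtain ⟨s, hs, hsJ⟩ := SetLike.not_le_iff_exists.1 (Nat.find_min hex (m := k) (by omega))
    have hms : ∀ a ∈ maximalIdeal A, a * s ∈ J := fun a ha ↦
      hkJ (by rw [pow_succ']; exact Ideal.mul_mem_mul ha hs)
    have hcolon : ∀ a, a * s ∈ J → a ∈ maximalIdeal A := fun a ha hu ↦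
      hsJ ((Ideal.unit_mul_mem_iff_mem J hu).1 ha)
    have hlt : J < J ⊔ Ideal.span {s} := left_lt_sup.2
      fun h ↦ hsJ (h (Ideal.mem_span_singleton_self s))
    have hr' := ih _ hlt (hn.trans hlt.le) r (Ideal.map_mono hlt.le hr)
    rw [Ideal.map_sup, Ideal.map_span, Set.image_singleton] at hr'
    obtain ⟨j, hj, w, hw, rfl⟩ := Submodule.mem_sup.1 hr'
    obtain ⟨t, rfl⟩ := Ideal.mem_span_singleton.1 hw
    -- Induction for `J + (s)` gave `r = j + s t`. The colon lemma turns this membership into one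
    -- for `x * t` on the closed fibre, where `x` cancels.
    have hst : algebraMap A S s * (x * t) ∈ J.map (algebraMap A S) := by
      have := Ideal.sub_mem _ hr (Ideal.mul_mem_left _ x hj)
      convert this using 1
      ring
    obtain ht := hx t (mem_map_colon_of_algebraMap_mul_mem hcolon hst)
    refine Ideal.add_mem _ hj ?_
    have hle : (maximalIdeal A).map (algebraMap A S) * Ideal.span {algebraMap A S s} ≤
        J.map (algebraMap A S) := by
      rw [← Set.image_singleton, ← Ideal.map_span, ← Ideal.map_mul]
      refine Ideal.map_mono (Ideal.mul_le.2 fun a ha b hb ↦ ?_)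
      obtain ⟨c, rfl⟩ := Ideal.mem_span_singleton.1 hb
      rw [← mul_assoc]
      exact J.mul_mem_right c (hms a ha)
    rw [mul_comm]
    exact hle (Ideal.mul_mem_mul ht (Ideal.mem_span_singleton_self _))
  have hloc : (maximalIdeal A).map (algebraMap A S) ≤ maximalIdeal S :=
    Ideal.map_le_iff_le_comap.2 (maximalIdeal_comap (algebraMap A S)).ge
  -- An arbitrary `J` is approximated by the ideals `J ⊔ maximalIdeal A ^ n`.
  have hmem : ∀ n, r ∈ J.map (algebraMap A S) ⊔ maximalIdeal S ^ n := fun n ↦ by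
    have h := key n (J ⊔ maximalIdeal A ^ n) le_sup_right r (Ideal.map_mono le_sup_left hr)
    rw [Ideal.map_sup, Ideal.map_pow] at h
    exact (sup_le_sup le_rfl (Ideal.pow_right_mono hloc n) :
      _ ≤ J.map (algebraMap A S) ⊔ maximalIdeal S ^ n) h
  have hkrull := (maximalIdeal S).iInf_pow_smul_eq_bot_of_isLocalRing
    (M := S ⧸ J.map (algebraMap A S)) (maximalIdeal.isMaximal S).ne_top
  rw [← Ideal.Quotient.eq_zero_iff_mem, ← Submodule.mem_bot (R := S), ← hkrull,
    Submodule.mem_iInf]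
  intro n
  obtain ⟨j, hj, w, hw, rfl⟩ := Submodule.mem_sup.1 (hmem n)
  rw [map_add, Ideal.Quotient.eq_zero_iff_mem.2 hj, zero_add]
  have := Submodule.smul_mem_smul hw
    (Submodule.mem_top (R := S) (x := (1 : S ⧸ J.map (algebraMap A S))))
  simpa [Algebra.smul_def] using this

/-- An ideal `I` of `S` such that no prime containing it contracts into an associated prime of `A`
contains the image of a nonzerodivisor of `A`. -/
theorem Ideal.exists_mem_nonZeroDivisors_algebraMap_mem {A S : Type*} [CommRing A] [CommRing S]
    [IsNoetherianRing A] [IsNoetherianRing S] [Algebra A S] {I : Ideal S}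
    (h : ∀ q ∈ PrimeSpectrum.zeroLocus (I : Set S), ∀ p ∈ associatedPrimes A A,
      ¬ q.asIdeal.comap (algebraMap A S) ≤ p) :
    ∃ a ∈ nonZeroDivisors A, algebraMap A S a ∈ I := by
  by_contra! hcon
  obtain ⟨p, hp, hle⟩ := ((I.comap (algebraMap A S)).subset_union_prime_finite
    (associatedPrimes.finite A A) (f := id) 0 0 fun _ h _ _ ↦ h.isPrime).1 <| by
      simp_rw [id, biUnion_associatedPrimes_eq_compl_nonZeroDivisors]
      exact fun a ha h ↦ hcon a h ha
  have := hp.isPrime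
  -- The radical is a finite intersection of minimal primes over `I`, so the prime `p` must contain
  -- the contraction of one of them.
  have hrad : (I.radical).comap (algebraMap A S) ≤ p := by
    rw [Ideal.comap_radical]
    exact (Ideal.IsPrime.radical_le_iff ‹_›).2 hle
  have hfin := I.finite_minimalPrimes_of_isNoetherianRing S
  rw [← Ideal.sInf_minimalPrimes, sInf_eq_iInf, Ideal.comap_iInf] at hrad
  simp_rw [Ideal.comap_iInf] at hrad
  have hinf : hfin.toFinset.inf (fun q ↦ q.comap (algebraMap A S)) ≤ p := by
    refine le_trans ?_ hrad
    refine le_iInf₂ fun q hq ↦ Finset.inf_le (hfin.mem_toFinset.2 hq)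
  obtain ⟨q, hq, hqp⟩ := (Ideal.IsPrime.inf_le' ‹_›).1 hinf
  have hq := hfin.mem_toFinset.1 hq
  exact h ⟨q, hq.1.1⟩ hq.1.2 p hp hqp

theorem propositions1p8 {A : Type u} {R : Type v} [CommRing A] [CommRing R]
    [IsLocalRing A] [IsLocalRing R] [IsNoetherianRing A] [IsNoetherianRing R]
    [Algebra A R] [IsLocalHom (algebraMap A R)] [Module.Flat A R]
    (hsep : IsSeparableFieldExtension (IsLocalRing.ResidueField A) (IsLocalRing.ResidueField R))
    (hreg : IsRegularRing (R ⊗[A] IsLocalRing.ResidueField A))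
    (I : Ideal R) (hI : I ≠ ⊤)
    (ha : ∀ q ∈ PrimeSpectrum.zeroLocus (I : Set R), ∀ p ∈ associatedPrimes A A,
      ¬ q.asIdeal.comap (algebraMap A R) ≤ p)
    (hb : ¬ I ≤ (IsLocalRing.maximalIdeal A).map (algebraMap A R)) :
    2 ≤ idealDepth I := by
  let m := (maximalIdeal A).map (algebraMap A R)
  have hmm : m ≤ maximalIdeal R := Ideal.map_le_iff_le_comap.2 (maximalIdeal_comap (algebraMap A R)).ge
  have hm : m.IsPrime := by
    have : Nontrivial (R ⧸ m) := Ideal.Quotient.nontrivial_iff.2 fun h ↦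
      (maximalIdeal.isMaximal R).ne_top (top_le_iff.1 (h ▸ hmm))
    have : IsLocalRing (R ⧸ m) := .of_surjective' _ Ideal.Quotient.mk_surjective
    have : IsRegularRing (R ⧸ m) := .of_ringEquiv (R := R ⊗[A] ResidueField A)
      (Algebra.TensorProduct.quotIdealMapEquivTensorQuot R (maximalIdeal A)).symm.toRingEquiv
    have : IsRegularLocalRing (R ⧸ m) := .of_isRegularRing_of_isLocalRing _
    exact (Ideal.Quotient.isDomain_iff_prime m).1 IsRegularLocalRing.isDomain
  obtain ⟨a, ha0, haI⟩ := Ideal.exists_mem_nonZeroDivisors_algebraMap_mem ha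
  obtain ⟨x, hxI, hxm⟩ := SetLike.not_le_iff_exists.1 hb
  -- Taking `J = (a)` makes `x` regular modulo `aR`.
  have hx := fun r ↦ Module.Flat.mem_map_of_mul_mem_map (A := A) (S := R) (x := x) (r := r)
    (fun r hr ↦ (hm.mem_or_mem hr).resolve_left hxm) (Ideal.span {a})
  rw [Ideal.map_span, Set.image_singleton] at hx
  have hmem : ∀ r ∈ [algebraMap A R a, x], r ∈ I := by simp [haI, hxI]
  have hreg2 : RingTheory.Sequence.IsRegular R [algebraMap A R a, x] := by
    refine .of_isWeaklyRegular_of_mem_maximalIdeal _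
      (fun r hr ↦ le_maximalIdeal hI (hmem r hr)) (.cons ?_ (.cons ?_ (.nil _ _)))
    · exact (IsLeftRegular.isSMulRegular
        (isRegular_iff_mem_nonZeroDivisors.2 ha0).left).of_flat
    · rw [isSMulRegular_iff_right_eq_zero_of_smul]
      intro z hz
      obtain ⟨r, rfl⟩ := Submodule.mkQ_surjective _ z
      rw [← map_smul, Submodule.mkQ_apply, Submodule.Quotient.mk_eq_zero,
        ← Submodule.ideal_span_singleton_smul, smul_eq_mul, Ideal.mul_top] at hz
      rw [Submodule.mkQ_apply, Submodule.Quotient.mk_eq_zero,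
        ← Submodule.ideal_span_singleton_smul, smul_eq_mul, Ideal.mul_top]
      exact hx r hz
  exact le_iSup₂_of_le _ hreg2 (le_iSup_of_le hmem le_rfl)
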